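/- Notation. For $f:\mathbb R^d\to\mathbb R$, the Fréchet subdifferential $\tilde\partial f(x)$ is the set of $u\in\mathbb R^d$ with $\liminf_{z\to x,\,z\ne x}\frac{f(z)-f(x)-\langle u,z-x\rangle}{\|z-x\|_2}\ge 0$. The limiting subdifferential $\partial f(x)$ is the set of limits of sequences $u^k\in\tilde\partial f(x^k)$ with $x^k\to x$ and $f(x^k)\to f(x)$. A point $x$ is a critical point of $f$ if $0\in\partial f(x)$, and a Fréchet critical point if $0\in\tilde\partial f(x)$. For $h:\mathbb R^d\to\mathbb R$, $t\in\mathbb R^d$ and $\kappa\in\mathbb R$, the degree of nonconvexity is $$\theta_h(t,\kappa)=\sup_{s\ne t,\;u\in\tilde\partial h(s),\;v\in\tilde\partial h(t)}\frac{-(s-t)^\top(u-v)-\kappa\|s-t\|_2^2}{\|s-t\|_2}\in[-\infty,\infty].$$ Let $X\in\mathbb R^{n\times d}$, $r=\operatorname{rank}(X)$, $y\in\mathbb R^n$, $\|u\|_X=\|Xu\|_2$, and let $h:\mathbb R^d\to\mathbb R$ be an arbitrary regularizer. For $P\in\mathbb R^{\tilde n\times n}$ put $$f(\beta)=\tfrac12\|y-X\beta\|_2^2+h(\beta),\qquad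 \tilde f(\beta)=\tfrac12\beta^\top (PX)^\top(PX)\beta-\langle y,X\beta\rangle+h(\beta).$$ $P$ is a $(1\pm\varepsilon)$ $\ell^2$-subspace embedding for $X$ if $(1-\varepsilon)\|X\beta\|_2^2\le\|PX\beta\|_2^2\le(1+\varepsilon)\|X\beta\|_2^2$ for all $\beta\in\mathbb R^d$. A probability distribution on $\tilde n\times n$ matrices is an $(\varepsilon,\delta)$ oblivious $\ell^2$-subspace embedding if for each fixed $X\in\mathbb R^{n\times d}$ a matrix $P$ drawn from it is, with probability at least $1-\delta$, a $(1\pm\varepsilon)$ $\ell^2$-subspace embedding for $X$. Theorem. Let $0<\varepsilon<1$ and $0<\delta<1$. (1) Let $P$ be drawn from an $(\varepsilon,\delta)$ oblivious $\ell^2$-subspace embedding over $\tilde n\times n$ matrices. Then with probability at least $1-\delta$, for every Fréchet critical point $\beta^*$ of $f$, every critical point $\tilde\beta^*$ of $\tilde f$ and every $\kappa\in\mathbb R$, $$(1-\varepsilon)\|\tilde\beta^*-\beta^*\|_X^2-\varepsilon\|\tilde\beta^*-\beta^*\|_X\|\beta^*\|_X\le\theta_h(\beta^*,\kappa)\|\tilde\beta^*-\beta^*\|_2+\kappa\|\tilde\beta^*-\beta^*\|_2^2,\qquad(\ast)$$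 with the convention $(\pm\infty)\cdot 0=0$. (2) There is an absolute constant $C>0$ such that, if $P=P'/\sqrt{\tilde n}$ with $P'\in\mathbb R^{\tilde n\times n}$ having i.i.d. standard Gaussian entries and $\tilde n\ge C\,(r+\log\frac1\delta)\,\varepsilon^{-2}$, then with probability at least $1-\delta$, $P$ is a $(1\pm\varepsilon)$ $\ell^2$-subspace embedding for $X$ and $(\ast)$ holds for all $\beta^*,\tilde\beta^*,\kappa$ as in (1). (3) There is an absolute constant $C>0$ such that, if $\tilde n\ge1$ and $P\in\mathbb R^{\tilde n\times n}$ is the sparse embedding (each column $i$ has one nonzero entry $\sigma(i)$, in row $g(i)$, where all $g(i)$ are uniform in $\{1,\dots,\tilde n\}$, all $\sigma(i)$ are uniform in $\{1,-1\}$, and all of these are independent) and $\tilde n\ge C\,r^2/(\delta\varepsilon^2)$, then with probability at least $1-\delta$, $P$ is a $(1\pm\varepsilon)$ $\ell^2$-subspace embedding for $X$ and $(\ast)$ holds for all $\beta^*,\tilde\beta^*,\kappa$ as in (1). -/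

import Mathlib

open MeasureTheory ProbabilityTheory Filter Topology
open scoped Matrix

noncomputable section

/-- `ℝ^d` with the Euclidean norm. -/
abbrev Vec (d : ℕ) : Type := EuclideanSpace ℝ (Fin d)

/-- The product (equivalently, Borel) σ-algebra on real matrices. -/
instance instMeasurableSpaceRealMatrix (m n : ℕ) :
    MeasurableSpace (Matrix (Fin m) (Fin n) ℝ) :=
  inferInstanceAs (MeasurableSpace (Fin m → Fin n → ℝ))

/-! ### Subdifferentials and critical points -/

/-- The Fréchet subdifferential of `f` at `x`: the vectors `u` with
`liminf_{y → x, y ≠ x} (f y - f x - ⟨u, y - x⟩) / ‖y - x‖ ≥ 0`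
(the lower limit is taken in the extended reals). -/
def frechetSubdiff {d : ℕ} (f : Vec d → ℝ) (x : Vec d) : Set (Vec d) :=
  {u | (0 : EReal) ≤ liminf
    (fun y : Vec d => (((f y - f x - inner ℝ u (y - x)) / ‖y - x‖ : ℝ) : EReal)) (𝓝[≠] x)}

/-- The limiting subdifferential of `f` at `x`. -/
def limitingSubdiff {d : ℕ} (f : Vec d → ℝ) (x : Vec d) : Set (Vec d) :=
  {u | ∃ (xs us : ℕ → Vec d),
    Tendsto xs atTop (𝓝 x) ∧ Tendsto (fun k => f (xs k)) atTop (𝓝 (f x)) ∧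
    (∀ k, us k ∈ frechetSubdiff f (xs k)) ∧ Tendsto us atTop (𝓝 u)}

/-- `x` is a critical point of `f` if `0` is a limiting subgradient of `f` at `x`. -/
def IsCriticalPoint {d : ℕ} (f : Vec d → ℝ) (x : Vec d) : Prop :=
  (0 : Vec d) ∈ limitingSubdiff f x

/-- `x` is a Fréchet critical point of `f` if `0` is a Fréchet subgradient of `f` at `x`. -/
def IsFrechetCriticalPoint {d : ℕ} (f : Vec d → ℝ) (x : Vec d) : Prop :=
  (0 : Vec d) ∈ frechetSubdiff f x

/-- The degree of nonconvexity `θ_h(t, κ)`: the supremum, in the extended reals, of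
`(-(s - t)ᵀ(u - v) - κ‖s - t‖²) / ‖s - t‖` over `s ≠ t`, and Fréchet subgradients `u` of `h`
at `s` and `v` of `h` at `t`. -/
def degreeNonconvexity {d : ℕ} (h : Vec d → ℝ) (t : Vec d) (κ : ℝ) : EReal :=
  ⨆ (s : Vec d) (_ : s ≠ t) (u : Vec d) (_ : u ∈ frechetSubdiff h s)
    (v : Vec d) (_ : v ∈ frechetSubdiff h t),
    (((-(inner ℝ (s - t) (u - v)) - κ * ‖s - t‖ ^ 2) / ‖s - t‖ : ℝ) : EReal)

/-! ### The original and the sketched objective -/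

/-- The seminorm `‖u‖_X = ‖X u‖₂`. -/
def dataNorm {n d : ℕ} (X : Matrix (Fin n) (Fin d) ℝ) (u : Vec d) : ℝ :=
  ‖Matrix.toEuclideanLin X u‖

/-- `f(β) = ½‖y - Xβ‖² + h(β)`. -/
def objective {n d : ℕ} (X : Matrix (Fin n) (Fin d) ℝ) (y : Vec n) (h : Vec d → ℝ)
    (β : Vec d) : ℝ :=
  (1 / 2) * ‖y - Matrix.toEuclideanLin X β‖ ^ 2 + h β

/-- `f̃(β) = ½ βᵀ X̃ᵀ X̃ β - ⟨y, Xβ⟩ + h(β)` with `X̃ = P X`. -/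
def sketchedObjective {m n d : ℕ} (P : Matrix (Fin m) (Fin n) ℝ)
    (X : Matrix (Fin n) (Fin d) ℝ) (y : Vec n) (h : Vec d → ℝ) (β : Vec d) : ℝ :=
  (1 / 2) * inner ℝ β (Matrix.toEuclideanLin ((P * X)ᵀ * (P * X)) β)
    - inner ℝ y (Matrix.toEuclideanLin X β) + h β

/-! ### Subspace embeddings -/

/-- `P` is a `(1 ± ε)` `ℓ²`-subspace embedding for `X`. -/
def IsSubspaceEmbedding {m n d : ℕ} (ε : ℝ) (P : Matrix (Fin m) (Fin n) ℝ)
    (X : Matrix (Fin n) (Fin d) ℝ) : Prop :=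
  ∀ β : Vec d,
    (1 - ε) * ‖Matrix.toEuclideanLin X β‖ ^ 2 ≤ ‖Matrix.toEuclideanLin (P * X) β‖ ^ 2 ∧
    ‖Matrix.toEuclideanLin (P * X) β‖ ^ 2 ≤ (1 + ε) * ‖Matrix.toEuclideanLin X β‖ ^ 2

/-- With `μ`-probability at least `p` the property `Q` holds: it holds on a measurable event
whose probability is at least `p`. -/
def HoldsWithProb {Ω : Type*} [MeasurableSpace Ω] (μ : Measure Ω) (p : ℝ) (Q : Ω → Prop) : Prop :=
  ∃ E : Set Ω, MeasurableSet E ∧ ENNReal.ofReal p ≤ μ E ∧ ∀ ω ∈ E, Q ω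

/-- The distribution `μ` over `m × n` matrices is an `(ε, δ)` oblivious `ℓ²`-subspace embedding
(for data matrices with `d` columns). -/
def IsObliviousSubspaceEmbedding {m n : ℕ} (d : ℕ) (ε δ : ℝ)
    (μ : Measure (Matrix (Fin m) (Fin n) ℝ)) : Prop :=
  ∀ X : Matrix (Fin n) (Fin d) ℝ,
    HoldsWithProb μ (1 - δ) (fun P => IsSubspaceEmbedding ε P X)

/-- The law of `P'/√m`, where the entries of the `m × n` matrix `P'` are i.i.d. standard
Gaussian variables. -/
def gaussianSketch (m n : ℕ) : Measure (Matrix (Fin m) (Fin n) ℝ) :=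
  (Measure.pi fun _ : Fin m => Measure.pi fun _ : Fin n => gaussianReal 0 1).map
    (fun P' => (Matrix.of fun j i => P' j i / √(m : ℝ) : Matrix (Fin m) (Fin n) ℝ))

/-- The matrix whose column `i` has the entry `σ i` in row `g i`, and zeros elsewhere. -/
def sparseSketchMatrix {m n : ℕ} (g : Fin n → Fin m) (σ : Fin n → ℤˣ) :
    Matrix (Fin m) (Fin n) ℝ :=
  Matrix.of fun j i => if j = g i then ((σ i : ℤ) : ℝ) else 0

/-- The law of the sparse sketching matrix: the rows `g i` are uniform in `Fin m`, the signs
`σ i` are uniform in `{1, -1}`, and all of them are independent (that is, the pair `(g, σ)` is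
uniformly distributed). -/
def sparseSketch (m n : ℕ) [NeZero m] : Measure (Matrix (Fin m) (Fin n) ℝ) :=
  ((PMF.uniformOfFintype ((Fin n → Fin m) × (Fin n → ℤˣ))).map
    (fun gσ => sparseSketchMatrix gσ.1 gσ.2)).toMeasure

/-- The approximation error bound for the sketching matrix `P`: for every Fréchet critical point
`β` of the original objective, every critical point `β'` of the sketched objective and every
real `κ`,
`(1 - ε)‖β' - β‖_X² - ε‖β' - β‖_X ‖β‖_X ≤ θ_h(β, κ)‖β' - β‖₂ + κ‖β' - β‖₂²`. -/
def SketchErrorBound {m n d : ℕ} (ε : ℝ) (P : Matrix (Fin m) (Fin n) ℝ)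
    (X : Matrix (Fin n) (Fin d) ℝ) (y : Vec n) (h : Vec d → ℝ) : Prop :=
  ∀ (β β' : Vec d) (κ : ℝ),
    IsFrechetCriticalPoint (objective X y h) β →
    IsCriticalPoint (sketchedObjective P X y h) β' →
    (((1 - ε) * dataNorm X (β' - β) ^ 2 - ε * dataNorm X (β' - β) * dataNorm X β : ℝ) : EReal) ≤
      degreeNonconvexity h β κ * ((‖β' - β‖ : ℝ) : EReal) + ((κ * ‖β' - β‖ ^ 2 : ℝ) : EReal)

end

/-! The error bound is deterministic once `P` embeds the column space. Put B = X, A = PX and D = β'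
- β. Criticality gives v = Bᵀ(y - Bβ) as a Fréchet subgradient of h at β, and u = Bᵀy - AᵀAβ' as a
limit of Fréchet subgradients of h at points tending to β'. In u - v the data y cancel, and -⟨D, u -
v⟩ = ‖AD‖² + (⟨AD, Aβ⟩ - ⟨BD, Bβ⟩). The embedding bounds ‖AD‖² below and, by polarization
(`abs_inner_sub_inner_le`), the bracket by ε‖BD‖‖Bβ‖. The degree of nonconvexity bounds the left
side above. This is `IsSubspaceEmbedding.sketchErrorBound`; it covers all β, β', κ on the same
event, so no probability is lost.

It remains to show that the two sketches embed the column space, of dimension r, with probability 1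
- δ. For the sparse sketch, the distortion is at most the Frobenius norm of the error of the Gram
matrix of an orthonormal basis. Each of its r² entries is a Rademacher chaos over colliding pairs,
with second moment at most 2/m (`sum_sparse_distortion_sq_le`), and Markov's inequality finishes.
For the Gaussian sketch, a chi-squared tail bound at each point of a net of at most 5^r points
(`gaussianSketch_tail`), a union bound, and the passage from the net to the whole space
(`abs_norm_sq_sub_norm_sq_le_of_net`) suffice. -/

section Deterministic

/-! ### Polarization of the embedding inequality -/

/-- If two linear maps have comparable squared norms, then they have comparable inner products. -/
theorem abs_inner_sub_inner_le {V E F : Type*} [AddCommGroup V] [Module ℝ V]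
    [NormedAddCommGroup E] [InnerProductSpace ℝ E] [NormedAddCommGroup F] [InnerProductSpace ℝ F]
    (L : V →ₗ[ℝ] E) (M : V →ₗ[ℝ] F) {ε : ℝ}
    (h : ∀ v, |‖L v‖ ^ 2 - ‖M v‖ ^ 2| ≤ ε * ‖M v‖ ^ 2) (a b : V) :
    |inner ℝ (L a) (L b) - inner ℝ (M a) (M b)| ≤ ε * ‖M a‖ * ‖M b‖ := by
  have key : ∀ a b, |inner ℝ (L a) (L b) - inner ℝ (M a) (M b)| ≤
      ε / 2 * (‖M a‖ ^ 2 + ‖M b‖ ^ 2) := by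
    intro a b
    have h1 := abs_le.1 (h (a + b))
    have h2 := abs_le.1 (h (a - b))
    simp only [map_add, map_sub, norm_add_sq_real, norm_sub_sq_real] at h1 h2
    rw [abs_le]
    constructor <;> linarith [h1.1, h1.2, h2.1, h2.2]
  have zero : ∀ v, ‖M v‖ = 0 → M v = 0 ∧ L v = 0 := by
    intro v hv
    have := h v
    rw [hv] at this
    have h0 : ‖L v‖ ^ 2 = 0 := by simpa using this
    exact ⟨norm_eq_zero.1 hv, by simpa using h0⟩
  rcases eq_or_ne ‖M a‖ 0 with ha | ha
  · simp [zero a ha]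
  rcases eq_or_ne ‖M b‖ 0 with hb | hb
  · simp [zero b hb]
  have hab : 0 < ‖M a‖ * ‖M b‖ := by positivity
  -- Rescaling gives both arguments the same `M`-norm, where the arithmetic mean in `key` equals the
  -- geometric mean.
  have := key (‖M b‖ • a) (‖M a‖ • b)
  simp only [map_smul, inner_smul_left, inner_smul_right, norm_smul, norm_norm,
    RCLike.conj_to_real] at this
  rw [show ‖M a‖ * (‖M b‖ * inner ℝ (L a) (L b)) - ‖M a‖ * (‖M b‖ * inner ℝ (M a) (M b)) =
    (‖M a‖ * ‖M b‖) * (inner ℝ (L a) (L b) - inner ℝ (M a) (M b)) by ring, abs_mul,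
    abs_of_pos hab] at this
  refine le_of_mul_le_mul_left (this.trans_eq ?_) hab
  ring

/-! ### Subdifferential calculus and the deterministic error bound -/

theorem mem_frechetSubdiff_iff {d : ℕ} {f : Vec d → ℝ} {x u : Vec d} :
    u ∈ frechetSubdiff f x ↔ ∀ c < (0 : ℝ), ∀ᶠ y in 𝓝[≠] x,
      c < (f y - f x - inner ℝ u (y - x)) / ‖y - x‖ := by
  rw [frechetSubdiff, Set.mem_ofPred_eq, le_liminf_iff]
  constructor
  · intro h c hc
    filter_upwards [h c (by exact_mod_cast hc)] with y hy
    exact_mod_cast hy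
  · intro h c hc
    obtain ⟨b, hcb, hb⟩ := EReal.lt_iff_exists_real_btwn.1 hc
    filter_upwards [h b (by exact_mod_cast hb)] with y hy
    exact hcb.trans (by exact_mod_cast hy)

/-- Fréchet subgradients of a sum with a differentiable function. -/
theorem sub_mem_frechetSubdiff_of_hasGradientAt {d : ℕ} {q h : Vec d → ℝ} {x u g : Vec d}
    (hq : HasGradientAt q g x) (hu : u ∈ frechetSubdiff (fun z => q z + h z) x) :
    u - g ∈ frechetSubdiff h x := by
  rw [mem_frechetSubdiff_iff] at hu ⊢
  intro c hc
  have ho := (hasGradientAt_iff_isLittleO.1 hq)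
  -- The negative tolerance `c` is split in half between the subgradient inequality and the
  -- linearization error of `q`.
  have hb := (ho.def (c := -c / 2) (by linarith)).filter_mono (nhdsWithin_le_nhds (s := {x}ᶜ))
  filter_upwards [hu (c / 2) (by linarith), hb, self_mem_nhdsWithin] with y h1 h2 hy
  have hpos : 0 < ‖y - x‖ := norm_pos_iff.2 (sub_ne_zero.2 hy)
  rw [lt_div_iff₀ hpos] at h1 ⊢
  rw [Real.norm_eq_abs, abs_le] at h2
  rw [inner_sub_left]
  linarith [h2.1, h2.2]

theorem le_degreeNonconvexity {d : ℕ} {h : Vec d → ℝ} {s t u v : Vec d} (κ : ℝ) (hst : s ≠ t)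
    (hu : u ∈ frechetSubdiff h s) (hv : v ∈ frechetSubdiff h t) :
    (((-(inner ℝ (s - t) (u - v)) - κ * ‖s - t‖ ^ 2) / ‖s - t‖ : ℝ) : EReal) ≤
      degreeNonconvexity h t κ := by
  unfold degreeNonconvexity
  exact le_iSup₂_of_le s hst (le_iSup₂_of_le u hu (le_iSup₂_of_le v hv le_rfl))

theorem hasGradientAt_half_norm_sq {d k : ℕ} (A : Vec d →ₗ[ℝ] Vec k) (c : Vec k) (x : Vec d) :
    HasGradientAt (fun z => (1 / 2 : ℝ) * ‖c - A z‖ ^ 2) (-(A.adjoint (c - A x))) x := by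
  have hA : HasFDerivAt (fun z => c - A z) (-A.toContinuousLinearMap) x :=
    A.toContinuousLinearMap.hasFDerivAt.const_sub c
  have := (hA.norm_sq).const_mul (1 / 2 : ℝ)
  rw [hasGradientAt_iff_hasFDerivAt]
  refine this.congr_fderiv ?_
  ext w
  simp [LinearMap.adjoint_inner_left, innerSL_apply_apply]

theorem hasGradientAt_half_norm_sq_sub {d k n : ℕ} (A : Vec d →ₗ[ℝ] Vec k)
    (B : Vec d →ₗ[ℝ] Vec n) (y : Vec n) (x : Vec d) :
    HasGradientAt (fun z => (1 / 2 : ℝ) * ‖A z‖ ^ 2 - inner ℝ y (B z))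
      (A.adjoint (A x) - B.adjoint y) x := by
  have hA : HasFDerivAt (fun z => A z) A.toContinuousLinearMap x :=
    A.toContinuousLinearMap.hasFDerivAt
  have hB : HasFDerivAt (fun z => inner ℝ y (B z))
      ((innerSL ℝ y).comp B.toContinuousLinearMap) x :=
    ((innerSL ℝ y).comp B.toContinuousLinearMap).hasFDerivAt
  have := ((hA.norm_sq).const_mul (1 / 2 : ℝ)).sub hB
  rw [hasGradientAt_iff_hasFDerivAt]
  refine this.congr_fderiv ?_
  ext w
  simp [LinearMap.adjoint_inner_left, innerSL_apply_apply]

/-- Rewrites the quadratic form of the sketched objective as a squared norm, the shape whose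
gradient is computed above. -/
theorem inner_toEuclideanLin_transpose_mul_self {d k : ℕ} (A : Matrix (Fin k) (Fin d) ℝ)
    (x : Vec d) :
    inner ℝ x (Matrix.toEuclideanLin (Aᵀ * A) x) = ‖Matrix.toEuclideanLin A x‖ ^ 2 := by
  rw [← real_inner_self_eq_norm_sq, ← LinearMap.adjoint_inner_right,
    ← Matrix.toEuclideanLin_conjTranspose_eq_adjoint, Matrix.conjTranspose_eq_transpose_of_trivial]
  congr 1
  simp [Matrix.toLpLin_apply, Matrix.mulVec_mulVec]

theorem toEuclideanLin_mul_apply {m n d : ℕ} (P : Matrix (Fin m) (Fin n) ℝ)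
    (X : Matrix (Fin n) (Fin d) ℝ) (β : Vec d) :
    Matrix.toEuclideanLin (P * X) β = Matrix.toEuclideanLin P (Matrix.toEuclideanLin X β) := by
  simp [Matrix.toLpLin_apply, Matrix.mulVec_mulVec]

/-- A subspace embedding yields the error bound. -/
theorem IsSubspaceEmbedding.sketchErrorBound {m n d : ℕ} {ε : ℝ} {P : Matrix (Fin m) (Fin n) ℝ}
    {X : Matrix (Fin n) (Fin d) ℝ} (hP : IsSubspaceEmbedding ε P X) (y : Vec n) (h : Vec d → ℝ) :
    SketchErrorBound ε P X y h := by
  intro β β' κ hβ hβ'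
  -- If the points coincide, the degree may be infinite, but its product with 0 is 0 in `EReal`.
  rcases eq_or_ne β' β with rfl | hne
  · simp [dataNorm]
  set B := Matrix.toEuclideanLin X with hB
  set A := Matrix.toEuclideanLin (P * X) with hA
  have hv : B.adjoint (y - B β) ∈ frechetSubdiff h β := by
    simpa using sub_mem_frechetSubdiff_of_hasGradientAt (hasGradientAt_half_norm_sq B y β) hβ
  obtain ⟨xs, us, hxs, -, hus, hus0⟩ := hβ'
  have hu : ∀ k, us k - (A.adjoint (A (xs k)) - B.adjoint y) ∈ frechetSubdiff h (xs k) := by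
    intro k
    refine sub_mem_frechetSubdiff_of_hasGradientAt (hasGradientAt_half_norm_sq_sub A B y (xs k)) ?_
    convert hus k using 2
    ext z
    rw [sketchedObjective, inner_toEuclideanLin_transpose_mul_self]
  set D := β' - β with hD
  have hDpos : 0 < ‖D‖ := norm_pos_iff.2 (sub_ne_zero.2 hne)
  have hcA : Continuous A := A.continuous_of_finiteDimensional
  have hcA' : Continuous A.adjoint := A.adjoint.continuous_of_finiteDimensional
  -- The limit of the subgradients of `h` need not be a Fréchet subgradient at `β'`, so the supremum
  -- is used along the sequence and the real quotients pass to the limit.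
  have hlim : Tendsto (fun k => (-(inner ℝ (xs k - β)
      ((us k - (A.adjoint (A (xs k)) - B.adjoint y)) - B.adjoint (y - B β)))
      - κ * ‖xs k - β‖ ^ 2) / ‖xs k - β‖) atTop
      (𝓝 ((-(inner ℝ D ((0 - (A.adjoint (A β') - B.adjoint y)) - B.adjoint (y - B β)))
        - κ * ‖D‖ ^ 2) / ‖D‖)) := by
    have hx : Tendsto (fun k => xs k - β) atTop (𝓝 D) := hxs.sub_const β
    have hAx : Tendsto (fun k => A.adjoint (A (xs k))) atTop (𝓝 (A.adjoint (A β'))) :=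
      ((hcA'.comp hcA).tendsto β').comp hxs
    exact ((hx.inner ((hus0.sub (hAx.sub_const _)).sub_const _)).neg.sub
      ((hx.norm.pow 2).const_mul κ)).div hx.norm hDpos.ne'
  have hθ := le_of_tendsto ((continuous_coe_real_ereal.tendsto _).comp hlim) (by
    filter_upwards [hxs.eventually_ne hne] with k hk
    exact le_degreeNonconvexity κ hk (hu k) hv)
  have hinner : inner ℝ D ((0 - (A.adjoint (A β') - B.adjoint y)) - B.adjoint (y - B β)) =
      -(‖A D‖ ^ 2 + (inner ℝ (A D) (A β) - inner ℝ (B D) (B β))) := by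
    have e : β' = D + β := by simp [hD]
    rw [e]
    simp only [map_add, map_sub, inner_sub_right, inner_add_right, inner_zero_right,
      LinearMap.adjoint_inner_right, real_inner_self_eq_norm_sq]
    ring
  have hB2 := abs_inner_sub_inner_le A B (ε := ε) (fun v => by
    rw [abs_le]; constructor <;> linarith [(hP v).1, (hP v).2]) D β
  have hbound : (1 - ε) * ‖B D‖ ^ 2 - ε * ‖B D‖ * ‖B β‖ ≤
      ‖A D‖ ^ 2 + (inner ℝ (A D) (A β) - inner ℝ (B D) (B β)) := by
    linarith [(abs_le.1 hB2).1, (hP D).1]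
  rw [hinner] at hθ
  have hmul := mul_le_mul_of_nonneg_right hθ
    (show (0 : EReal) ≤ ((‖D‖ : ℝ) : EReal) by exact_mod_cast hDpos.le)
  refine le_trans ?_ (add_le_add_left hmul _)
  rw [← EReal.coe_mul, ← EReal.coe_add, EReal.coe_le_coe_iff, div_mul_cancel₀ _ hDpos.ne']
  simp only [dataNorm]
  linarith

/-! ### Probability, reduction to the column space, measurability -/

theorem HoldsWithProb.mono {Ω : Type*} [MeasurableSpace Ω] {μ : Measure Ω} {p : ℝ}
    {Q R : Ω → Prop} (h : HoldsWithProb μ p Q) (hQR : ∀ ω, Q ω → R ω) : HoldsWithProb μ p R :=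
  let ⟨E, hE, hp, hQ⟩ := h
  ⟨E, hE, hp, fun ω hω => hQR ω (hQ ω hω)⟩

/-- A property whose failure has probability at most `δ` holds with probability `1 - δ`. -/
theorem HoldsWithProb.of_compl {Ω : Type*} [MeasurableSpace Ω] {μ : Measure Ω}
    [IsProbabilityMeasure μ] {δ : ℝ} {Q : Ω → Prop} (hQ : MeasurableSet {ω | Q ω})
    (h : μ.real {ω | ¬ Q ω} ≤ δ) : HoldsWithProb μ (1 - δ) Q := by
  refine ⟨{ω | Q ω}, hQ, ?_, fun ω hω => hω⟩
  rw [ENNReal.ofReal_le_iff_le_toReal (measure_ne_top _ _)]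
  have : μ.real {ω | ¬ Q ω} = 1 - μ.real {ω | Q ω} := probReal_compl_eq_one_sub hQ
  change 1 - δ ≤ μ.real {ω | Q ω}
  linarith

/-- It suffices to control the distortion on the column space. -/
theorem isSubspaceEmbedding_of_range {m n d : ℕ} {ε : ℝ} {P : Matrix (Fin m) (Fin n) ℝ}
    {X : Matrix (Fin n) (Fin d) ℝ}
    (h : ∀ w : (Matrix.toEuclideanLin X).range,
      |‖Matrix.toEuclideanLin P w‖ ^ 2 - ‖w‖ ^ 2| ≤ ε * ‖w‖ ^ 2) :
    IsSubspaceEmbedding ε P X := by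
  intro β
  have := abs_le.1 (h ⟨_, LinearMap.mem_range_self _ β⟩)
  simp only [Submodule.coe_norm, ← toEuclideanLin_mul_apply] at this
  constructor <;> linarith [this.1, this.2]

theorem finrank_range_toEuclideanLin {n d : ℕ} (X : Matrix (Fin n) (Fin d) ℝ) :
    Module.finrank ℝ (Matrix.toEuclideanLin X).range = X.rank := by
  rw [X.rank_eq_finrank_range_toLin (EuclideanSpace.basisFun (Fin n) ℝ).toBasis
    (EuclideanSpace.basisFun (Fin d) ℝ).toBasis, Matrix.toEuclideanLin_eq_toLin_orthonormal]

theorem measurable_matrix_apply {m n : ℕ} (j : Fin m) (i : Fin n) :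
    Measurable fun P : Matrix (Fin m) (Fin n) ℝ => P j i :=
  (measurable_pi_apply i).comp (measurable_pi_apply (X := fun _ : Fin m => Fin n → ℝ) j)

theorem inner_toEuclideanLin {m n : ℕ} (P : Matrix (Fin m) (Fin n) ℝ) (u v : Vec n) :
    inner ℝ (Matrix.toEuclideanLin P u) (Matrix.toEuclideanLin P v) =
      ∑ k, (∑ i, P k i * u i) * ∑ i, P k i * v i := by
  simp only [PiLp.inner_apply, Matrix.toLpLin_apply, Matrix.mulVec, dotProduct, RCLike.inner_apply,
    conj_trivial]
  exact Finset.sum_congr rfl fun k _ => mul_comm _ _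

theorem measurable_inner_toEuclideanLin {m n : ℕ} (u v : Vec n) :
    Measurable fun P : Matrix (Fin m) (Fin n) ℝ =>
      inner ℝ (Matrix.toEuclideanLin P u) (Matrix.toEuclideanLin P v) := by
  simp only [inner_toEuclideanLin]
  have := @measurable_matrix_apply m n
  fun_prop

end Deterministic

/-! ### Sparse embedding: second moments and Markov's inequality -/

section Sparse

/-- The distortion of a linear map is at most the Frobenius norm of the distortion of the Gram
matrix of an orthonormal basis. -/
theorem abs_norm_sq_sub_norm_sq_le_of_gram {ι V E : Type*} [Fintype ι]
    [NormedAddCommGroup V] [InnerProductSpace ℝ V] [NormedAddCommGroup E] [InnerProductSpace ℝ E]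
    (b : OrthonormalBasis ι ℝ V) (L : V →ₗ[ℝ] E) {ε : ℝ} (hε : 0 ≤ ε)
    (h : ∑ p : ι × ι, (inner ℝ (L (b p.1)) (L (b p.2)) - inner ℝ (b p.1) (b p.2)) ^ 2 ≤ ε ^ 2)
    (w : V) : |‖L w‖ ^ 2 - ‖w‖ ^ 2| ≤ ε * ‖w‖ ^ 2 := by
  have expand : ‖L w‖ ^ 2 - ‖w‖ ^ 2 = ∑ p : ι × ι, (b.repr w p.1 * b.repr w p.2) *
      (inner ℝ (L (b p.1)) (L (b p.2)) - inner ℝ (b p.1) (b p.2)) := by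
    have hw := b.sum_repr w
    conv_lhs => rw [← real_inner_self_eq_norm_sq, ← real_inner_self_eq_norm_sq, ← hw]
    simp only [map_sum, map_smul, sum_inner, inner_sum, inner_smul_left, inner_smul_right,
      RCLike.conj_to_real, Fintype.sum_prod_type, ← Finset.sum_sub_distrib]
    refine Finset.sum_congr rfl fun i _ => ?_
    rw [Finset.mul_sum, Finset.mul_sum, ← Finset.sum_sub_distrib]
    refine Finset.sum_congr rfl fun j _ => ?_
    rw [real_inner_comm (L (b i)), real_inner_comm (b i)]
    ring
  have hn : ∑ p : ι × ι, (b.repr w p.1 * b.repr w p.2) ^ 2 = (‖w‖ ^ 2) ^ 2 := by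
    have : ‖w‖ ^ 2 = ∑ i, b.repr w i ^ 2 := by
      rw [← b.repr.norm_map w, EuclideanSpace.norm_sq_eq]
      simp
    rw [this, sq (∑ i, b.repr w i ^ 2), Finset.sum_mul_sum, Fintype.sum_prod_type]
    simp only [mul_pow]
  refine abs_le_of_sq_le_sq ?_ (by positivity)
  rw [expand]
  refine (Finset.sum_mul_sq_le_sq_mul_sq _ _ _).trans ?_
  rw [hn, mul_pow, mul_comm]
  gcongr

variable {ι : Type*} [Fintype ι] [DecidableEq ι]

/-- Flipping the sign at `a` permutes the sign patterns, so the sum equals its own negative. -/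
theorem sum_signs_eq_zero (f : (ι → ℤˣ) → ℝ) (a : ι)
    (hf : ∀ σ, f (σ * Pi.mulSingle a (-1)) = -f σ) : ∑ σ, f σ = 0 := by
  have := Equiv.sum_comp (Equiv.mulRight (Pi.mulSingle a (-1) : ι → ℤˣ)) f
  simp only [Equiv.coe_mulRight, hf, Finset.sum_neg_distrib] at this
  linarith

theorem intCast_sign_mul_self (z : ℤˣ) : ((z : ℤ) : ℝ) * ((z : ℤ) : ℝ) = 1 := by
  rw [← Int.cast_mul, ← Units.val_mul, Int.units_mul_self]
  simp

theorem sum_signs_mul_of_notMem {j k l a : ι} (hj : a ≠ j) (hk : a ≠ k) (hl : a ≠ l) :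
    ∑ σ : ι → ℤˣ, ((σ a : ℤ) : ℝ) * ((σ j : ℤ) : ℝ) *
      (((σ k : ℤ) : ℝ) * ((σ l : ℤ) : ℝ)) = 0 := by
  refine sum_signs_eq_zero _ a fun σ => ?_
  simp [Pi.mulSingle_eq_of_ne hj.symm, Pi.mulSingle_eq_of_ne hk.symm,
    Pi.mulSingle_eq_of_ne hl.symm]

/-- Unless the two pairs agree as unordered pairs, some index occurs exactly once among the four and
flipping its sign kills the sum; if they agree, the product of signs is 1. -/
theorem sum_signs_four {p q : ι × ι} (hp : p.1 ≠ p.2) (hq : q.1 ≠ q.2) :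
    ∑ σ : ι → ℤˣ, ((σ p.1 : ℤ) : ℝ) * ((σ p.2 : ℤ) : ℝ) *
      (((σ q.1 : ℤ) : ℝ) * ((σ q.2 : ℤ) : ℝ)) =
      (Fintype.card (ι → ℤˣ) : ℝ) * ((if q = p then 1 else 0) + if q = p.swap then 1 else 0) := by
  obtain ⟨i, j⟩ := p
  obtain ⟨k, l⟩ := q
  simp only [Prod.swap_prod_mk, Prod.mk.injEq] at hp hq ⊢
  by_cases h1 : i = k ∨ i = l
  · by_cases h2 : j = k ∨ j = l
    · rcases h1 with rfl | rfl
      · have h2 : j = l := h2.resolve_left hp.symm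
        subst h2
        have : ∀ x y : ℝ, x * y * (x * y) = (x * x) * (y * y) := fun x y => by ring
        simp only [this, intCast_sign_mul_self]
        simp [hp]
      · have h2 : j = k := h2.resolve_right hp.symm
        subst h2
        have : ∀ x y : ℝ, x * y * (y * x) = (x * x) * (y * y) := fun x y => by ring
        simp only [this, intCast_sign_mul_self]
        simp [hq]
    · push Not at h2
      have := sum_signs_mul_of_notMem hp.symm h2.1 h2.2
      simp only [mul_comm (((_ : ℤˣ) : ℤ) : ℝ) (((_ : ℤˣ) : ℤ) : ℝ)] at this ⊢
      rw [if_neg (by rintro ⟨-, rfl⟩; exact h2.2 rfl), if_neg (by rintro ⟨rfl, -⟩; exact h2.1 rfl)]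
      simp only [add_zero, mul_zero]
      rw [← this]
  · push Not at h1
    rw [sum_signs_mul_of_notMem hp h1.1 h1.2, if_neg (by rintro ⟨rfl, -⟩; exact h1.1 rfl),
      if_neg (by rintro ⟨-, rfl⟩; exact h1.2 rfl)]
    simp

/-- The second moment of an off-diagonal Rademacher chaos of order two. -/
theorem sum_rademacher_chaos_sq_le (w : ι × ι → ℝ) (hw : ∀ p : ι × ι, p.1 = p.2 → w p = 0) :
    ∑ σ : ι → ℤˣ, (∑ p : ι × ι, w p * (((σ p.1 : ℤ) : ℝ) * ((σ p.2 : ℤ) : ℝ))) ^ 2 ≤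
      (Fintype.card (ι → ℤˣ) : ℝ) * (2 * ∑ p, w p ^ 2) := by
  have hexp : ∑ σ : ι → ℤˣ,
      (∑ p : ι × ι, w p * (((σ p.1 : ℤ) : ℝ) * ((σ p.2 : ℤ) : ℝ))) ^ 2 =
      ∑ p : ι × ι, ∑ q : ι × ι, w p * w q * ((Fintype.card (ι → ℤˣ) : ℝ) *
        ((if q = p then 1 else 0) + if q = p.swap then 1 else 0)) := by
    simp only [sq, Finset.sum_mul_sum]
    rw [Finset.sum_comm]
    refine Finset.sum_congr rfl fun p _ => ?_
    rw [Finset.sum_comm]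
    refine Finset.sum_congr rfl fun q _ => ?_
    by_cases hp : p.1 = p.2
    · simp [hw p hp]
    by_cases hq : q.1 = q.2
    · simp [hw q hq]
    rw [← sum_signs_four hp hq, Finset.mul_sum]
    exact Finset.sum_congr rfl fun σ _ => by ring
  have hswap : ∑ p : ι × ι, w p.swap ^ 2 = ∑ p, w p ^ 2 :=
    Equiv.sum_comp (Equiv.prodComm ι ι) fun p => w p ^ 2
  have hcollapse : ∀ p : ι × ι, ∑ q : ι × ι, w p * w q * ((Fintype.card (ι → ℤˣ) : ℝ) *
        ((if q = p then 1 else 0) + if q = p.swap then 1 else 0)) =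
      (Fintype.card (ι → ℤˣ) : ℝ) * (w p * w p + w p * w p.swap) := by
    intro p
    simp only [mul_add, mul_ite, mul_one, mul_zero, Finset.sum_add_distrib, Finset.sum_ite_eq',
      Finset.mem_univ, if_true]
    ring
  rw [hexp]
  simp only [hcollapse, ← Finset.mul_sum]
  gcongr
  rw [two_mul]
  nth_rewrite 1 [← hswap]
  rw [← Finset.sum_add_distrib]
  -- By 2ab ≤ a² + b²; summing, the swap preserves the total, and 3/2 + 1/2 gives the factor 2.
  have : ∀ p ∈ Finset.univ, w p * w p + w p * w p.swap ≤
      (3 * w p ^ 2 + w p.swap ^ 2) / 2 := fun p _ => by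
    nlinarith [sq_nonneg (w p - w p.swap)]
  refine (Finset.sum_le_sum this).trans_eq ?_
  rw [← Finset.sum_div, Finset.sum_add_distrib, Finset.sum_add_distrib, ← Finset.mul_sum, hswap]
  ring

/-- The number of maps into `Fin m` that identify two given points. -/
theorem sum_collision {m : ℕ} [NeZero m] {i j : ι} (hij : i ≠ j) :
    (m : ℝ) * ∑ g : ι → Fin m, (if g i = g j then (1 : ℝ) else 0) =
      (Fintype.card (ι → Fin m) : ℝ) := by
  -- Translating the value at `i` modulo `m` permutes the maps, and for each map exactly one
  -- translation creates the collision; averaging over `c` replaces counting.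
  have hshift : ∀ c : Fin m, ∑ g : ι → Fin m, (if g i + c = g j then (1 : ℝ) else 0) =
      ∑ g : ι → Fin m, (if g i = g j then (1 : ℝ) else 0) := by
    intro c
    have := Equiv.sum_comp (Equiv.addRight (Pi.single i c : ι → Fin m))
      (fun g => if g i = g j then (1 : ℝ) else 0)
    simpa [Pi.single_eq_of_ne hij.symm] using this
  have h1 : ∑ c : Fin m, ∑ g : ι → Fin m, (if g i + c = g j then (1 : ℝ) else 0) =
      m * ∑ g : ι → Fin m, (if g i = g j then (1 : ℝ) else 0) := by
    simp only [hshift, Finset.sum_const, Finset.card_univ, Fintype.card_fin, nsmul_eq_mul]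
  rw [← h1, Finset.sum_comm]
  have h2 : ∀ g : ι → Fin m, ∑ c : Fin m, (if g i + c = g j then (1 : ℝ) else 0) = 1 := by
    intro g
    have : ∀ c : Fin m, (g i + c = g j) ↔ c = -g i + g j := fun c => by
      constructor <;> intro h
      · rw [← h]; abel
      · rw [h]; abel
    simp [this]
  simp [h2]

/-- The diagonal terms carry squared signs and reproduce ⟨u, v⟩ exactly, so only collisions of
distinct indices contribute to the error. -/
theorem inner_sparseSketchMatrix_sub {m n : ℕ} (g : Fin n → Fin m) (σ : Fin n → ℤˣ)
    (u v : Vec n) :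
    inner ℝ (Matrix.toEuclideanLin (sparseSketchMatrix g σ) u)
      (Matrix.toEuclideanLin (sparseSketchMatrix g σ) v) - inner ℝ u v =
    ∑ p : Fin n × Fin n, (if p.1 ≠ p.2 ∧ g p.1 = g p.2 then u p.1 * v p.2 else 0) *
      (((σ p.1 : ℤ) : ℝ) * ((σ p.2 : ℤ) : ℝ)) := by
  have h1 : inner ℝ u v = ∑ p : Fin n × Fin n, if p.1 = p.2 then u p.1 * v p.2 else 0 := by
    simp [Fintype.sum_prod_type, PiLp.inner_apply, mul_comm]
  have h2 : inner ℝ (Matrix.toEuclideanLin (sparseSketchMatrix g σ) u)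
      (Matrix.toEuclideanLin (sparseSketchMatrix g σ) v) =
      ∑ p : Fin n × Fin n, if g p.1 = g p.2 then
        u p.1 * v p.2 * (((σ p.1 : ℤ) : ℝ) * ((σ p.2 : ℤ) : ℝ)) else 0 := by
    rw [inner_toEuclideanLin]
    simp only [Finset.sum_mul_sum, Fintype.sum_prod_type]
    rw [Finset.sum_comm]
    refine Finset.sum_congr rfl fun i _ => ?_
    rw [Finset.sum_comm]
    refine Finset.sum_congr rfl fun j _ => ?_
    simp only [sparseSketchMatrix, Matrix.of_apply, ite_mul, mul_ite, zero_mul, mul_zero,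
      Finset.sum_ite_eq', Finset.mem_univ, if_true]
    exact if_congr eq_comm (by ring) rfl
  rw [h1, h2, ← Finset.sum_sub_distrib]
  refine Finset.sum_congr rfl fun ⟨i, j⟩ _ => ?_
  by_cases hij : i = j
  · subst hij
    rw [intCast_sign_mul_self]
    simp
  · by_cases hg : g i = g j <;> simp [hij, hg]

/-- The second moment of the distortion of an inner product under the sparse sketch. -/
theorem sum_sparse_distortion_sq_le {m n : ℕ} [NeZero m] (u v : Vec n) :
    ∑ gσ : (Fin n → Fin m) × (Fin n → ℤˣ),
      (inner ℝ (Matrix.toEuclideanLin (sparseSketchMatrix gσ.1 gσ.2) u)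
        (Matrix.toEuclideanLin (sparseSketchMatrix gσ.1 gσ.2) v) - inner ℝ u v) ^ 2 ≤
    (Fintype.card ((Fin n → Fin m) × (Fin n → ℤˣ)) : ℝ) * (2 / m * (‖u‖ ^ 2 * ‖v‖ ^ 2)) := by
  have hm : (0 : ℝ) < m := by exact_mod_cast Nat.pos_of_neZero m
  simp only [inner_sparseSketchMatrix_sub]
  rw [Fintype.sum_prod_type]
  refine (Finset.sum_le_sum fun g _ => sum_rademacher_chaos_sq_le
    (fun p => if p.1 ≠ p.2 ∧ g p.1 = g p.2 then u p.1 * v p.2 else 0) fun p hp =>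
      if_neg fun h => h.1 hp).trans ?_
  rw [← Finset.mul_sum, ← Finset.mul_sum, Finset.sum_comm]
  have hp : ∀ p ∈ (Finset.univ : Finset (Fin n × Fin n)), ∑ g : Fin n → Fin m,
      (if p.1 ≠ p.2 ∧ g p.1 = g p.2 then u p.1 * v p.2 else 0) ^ 2 ≤
      (Fintype.card (Fin n → Fin m) : ℝ) / m * (u p.1 ^ 2 * v p.2 ^ 2) := by
    intro p _
    by_cases h : p.1 = p.2
    · simp only [h, ne_eq, not_true_eq_false, false_and, if_false]
      simp only [ne_eq, OfNat.ofNat_ne_zero, not_false_eq_true, zero_pow, Finset.sum_const_zero]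
      positivity
    · rw [← sum_collision (m := m) h, mul_div_cancel_left₀ _ hm.ne', Finset.sum_mul]
      refine Finset.sum_le_sum fun g _ => ?_
      by_cases hg : g p.1 = g p.2 <;> simp [h, hg, mul_pow]
  refine (mul_le_mul_of_nonneg_left (mul_le_mul_of_nonneg_left (Finset.sum_le_sum hp)
    zero_le_two) (Nat.cast_nonneg _)).trans_eq ?_
  rw [← Finset.mul_sum, Fintype.sum_prod_type]
  simp only [← Finset.sum_mul_sum]
  rw [EuclideanSpace.norm_sq_eq, EuclideanSpace.norm_sq_eq, Fintype.card_prod]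
  simp only [Real.norm_eq_abs, sq_abs]
  push_cast
  ring

instance isProbabilityMeasure_sparseSketch (m n : ℕ) [NeZero m] :
    IsProbabilityMeasure (sparseSketch m n) :=
  inferInstanceAs (IsProbabilityMeasure (PMF.toMeasure _))

/-- Markov's inequality for the sparse sketch. -/
theorem sparseSketch_real_lt_le {m n : ℕ} [NeZero m] {F : Matrix (Fin m) (Fin n) ℝ → ℝ}
    (hF : Measurable F) (hF0 : ∀ P, 0 ≤ F P) {t K : ℝ} (ht : 0 < t)
    (h : ∑ gσ : (Fin n → Fin m) × (Fin n → ℤˣ), F (sparseSketchMatrix gσ.1 gσ.2) ≤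
      (Fintype.card ((Fin n → Fin m) × (Fin n → ℤˣ)) : ℝ) * K) :
    (sparseSketch m n).real {P | ¬ F P ≤ t} ≤ K / t := by
  classical
  have hmeas : MeasurableSet {P | ¬ F P ≤ t} := (measurableSet_le hF measurable_const).compl
  rw [measureReal_def, sparseSketch, PMF.toMeasure_apply_eq_toOuterMeasure_apply _ hmeas,
    PMF.toOuterMeasure_map_apply, PMF.toOuterMeasure_uniformOfFintype_apply, ENNReal.toReal_div,
    ENNReal.toReal_natCast, ENNReal.toReal_natCast, div_le_div_iff₀ (by positivity) ht]
  rw [mul_comm K]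
  refine le_trans ?_ h
  rw [← Finset.sum_filter_add_sum_filter_not Finset.univ
    (fun gσ : (Fin n → Fin m) × (Fin n → ℤˣ) => ¬ F (sparseSketchMatrix gσ.1 gσ.2) ≤ t)]
  refine le_trans ?_ (le_add_of_nonneg_right (Finset.sum_nonneg fun _ _ => hF0 _))
  refine le_trans ?_ (Finset.card_nsmul_le_sum _ _ t fun gσ hgσ =>
    (not_le.1 (Finset.mem_filter.1 hgσ).2).le)
  rw [nsmul_eq_mul]
  gcongr
  rw [Fintype.card_subtype]
  exact Finset.card_le_card fun x hx => by simpa using hx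

/-- The sparse sketch is a subspace embedding with high probability. -/
theorem sparseSketch_isSubspaceEmbedding {m n d : ℕ} [NeZero m] {ε δ : ℝ} (hε : 0 < ε)
    (hδ : 0 < δ) (X : Matrix (Fin n) (Fin d) ℝ)
    (hm : 2 * (X.rank : ℝ) ^ 2 / (δ * ε ^ 2) ≤ m) :
    HoldsWithProb (sparseSketch m n) (1 - δ) fun P => IsSubspaceEmbedding ε P X := by
  have hm0 : (0 : ℝ) < m := by exact_mod_cast Nat.pos_of_neZero m
  set b := stdOrthonormalBasis ℝ (Matrix.toEuclideanLin X).range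
  set F : Matrix (Fin m) (Fin n) ℝ → ℝ := fun P => ∑ p : Fin _ × Fin _,
    (inner ℝ (Matrix.toEuclideanLin P (b p.1)) (Matrix.toEuclideanLin P (b p.2)) -
      inner ℝ (b p.1 : Vec n) (b p.2 : Vec n)) ^ 2 with hFdef
  have hF : Measurable F := Finset.measurable_sum _ fun p _ =>
    ((measurable_inner_toEuclideanLin _ _).sub_const _).pow_const 2
  have hsum : ∑ gσ : (Fin n → Fin m) × (Fin n → ℤˣ), F (sparseSketchMatrix gσ.1 gσ.2) ≤
      (Fintype.card ((Fin n → Fin m) × (Fin n → ℤˣ)) : ℝ) * (2 * (X.rank : ℝ) ^ 2 / m) := by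
    simp only [hFdef]
    rw [Finset.sum_comm]
    refine (Finset.sum_le_sum fun p _ => sum_sparse_distortion_sq_le _ _).trans_eq ?_
    have : ∀ a, ‖(b a : Vec n)‖ = 1 := fun a => b.orthonormal.1 a
    simp only [this, Finset.sum_const, Finset.card_univ, Fintype.card_prod, Fintype.card_fin,
      finrank_range_toEuclideanLin, nsmul_eq_mul]
    push_cast
    ring
  refine HoldsWithProb.mono (Q := fun P => F P ≤ ε ^ 2) (HoldsWithProb.of_compl
    (measurableSet_le hF measurable_const) ?_) fun P hP => isSubspaceEmbedding_of_range fun w => ?_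
  · refine (sparseSketch_real_lt_le hF (fun P => Finset.sum_nonneg fun _ _ => sq_nonneg _)
      (by positivity) hsum).trans ?_
    rw [div_le_iff₀ (by positivity)] at hm
    rw [div_div, div_le_iff₀ (by positivity)]
    linarith
  · exact abs_norm_sq_sub_norm_sq_le_of_gram b
      ((Matrix.toEuclideanLin P).comp (Matrix.toEuclideanLin X).range.subtype) hε.le hP w

end Sparse

/-! ### Gaussian embedding: nets -/

section Gaussian

/-- The sphere of radius two has a finite net of resolution one with at most `5 ^ dim` points. -/
theorem exists_finset_net_sphere (V : Type*) [NormedAddCommGroup V] [InnerProductSpace ℝ V]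
    [FiniteDimensional ℝ V] :
    ∃ s : Finset V, (∀ c ∈ s, ‖c‖ = 2) ∧ s.card ≤ 5 ^ Module.finrank ℝ V ∧
      ∀ v : V, ‖v‖ = 2 → ∃ c ∈ s, ‖v - c‖ < 1 := by
  classical
  let p : Finset V → Prop := fun s =>
    (∀ c ∈ s, ‖c‖ = 2) ∧ ∀ c ∈ s, ∀ e ∈ s, c ≠ e → 1 ≤ ‖c - e‖
  have hcard : ∀ s, p s → s.card ≤ 5 ^ Module.finrank ℝ V := fun s hs =>
    Besicovitch.card_le_of_separated s (fun c hc => (hs.1 c hc).le) hs.2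
  -- A separated set of maximal size is a net, since a far point could be added to it. Radius two
  -- and separation one are the normalization of the Besicovitch bound.
  let K : Set ℕ := {k | ∃ s, p s ∧ s.card = k}
  have hK : BddAbove K := ⟨_, by rintro _ ⟨s, hs, rfl⟩; exact hcard s hs⟩
  obtain ⟨s, hs, hsc⟩ : sSup K ∈ K := Nat.sSup_mem ⟨0, ∅, by simp [p], rfl⟩ hK
  refine ⟨s, hs.1, hcard s hs, fun v hv => ?_⟩
  by_contra! hfar
  have hvs : v ∉ s := fun h => by simpa using (hfar v h).trans_lt (by simp : ‖v - v‖ < 1)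
  have hp : p (insert v s) := by
    refine ⟨fun c hc => ?_, fun c hc e he hce => ?_⟩
    · rcases Finset.mem_insert.1 hc with rfl | hc
      exacts [hv, hs.1 c hc]
    · rcases Finset.mem_insert.1 hc with hcv | hcs <;>
        rcases Finset.mem_insert.1 he with hev | hes
      · exact absurd (hcv.trans hev.symm) hce
      · exact hcv ▸ hfar e hes
      · rw [norm_sub_rev]; exact hev ▸ hfar c hcs
      · exact hs.2 c hcs e hes hce
  have := le_csSup hK ⟨_, hp, rfl⟩
  rw [Finset.card_insert_of_notMem hvs, hsc] at this
  omega

/-- The distortion of a linear map is controlled by its distortion on a net of the sphere of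
radius two. -/
theorem abs_norm_sq_sub_norm_sq_le_of_net {V E : Type*} [NormedAddCommGroup V]
    [InnerProductSpace ℝ V] [FiniteDimensional ℝ V] [NormedAddCommGroup E] [InnerProductSpace ℝ E]
    (L : V →ₗ[ℝ] E) {ε : ℝ} {s : Finset V} (hs : ∀ c ∈ s, ‖c‖ = 2)
    (hnet : ∀ v : V, ‖v‖ = 2 → ∃ c ∈ s, ‖v - c‖ < 1)
    (h : ∀ c ∈ s, |‖L c‖ ^ 2 - ‖c‖ ^ 2| ≤ ε / 32 * ‖c‖ ^ 2) (w : V) :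
    |‖L w‖ ^ 2 - ‖w‖ ^ 2| ≤ ε * ‖w‖ ^ 2 := by
  rcases eq_or_ne w 0 with rfl | hw
  · simp
  have hL : Continuous L := L.continuous_of_finiteDimensional
  have hw0 : 0 < ‖w‖ := norm_pos_iff.2 hw
  have hscale : ∀ w : V, w ≠ 0 → ‖(2 / ‖w‖) • w‖ = 2 := fun w hw => by
    rw [norm_smul, norm_div, norm_norm, Real.norm_ofNat, div_mul_cancel₀ _ (norm_ne_zero_iff.2 hw)]
  have hcont : Continuous fun v => |‖L v‖ ^ 2 - ‖v‖ ^ 2| := by fun_prop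
  obtain ⟨v, hv, hmax⟩ := (isCompact_sphere (0 : V) 2).exists_isMaxOn
    ⟨(2 / ‖w‖) • w, by simpa using hscale w hw⟩ hcont.continuousOn
  have hv2 : ‖v‖ = 2 := by simpa using hv
  set M := |‖L v‖ ^ 2 - ‖v‖ ^ 2| with hM
  have hall : ∀ x, |‖L x‖ ^ 2 - ‖x‖ ^ 2| ≤ M / 4 * ‖x‖ ^ 2 := by
    intro x
    rcases eq_or_ne x 0 with rfl | hx
    · simp
    have hx0 : 0 < ‖x‖ := norm_pos_iff.2 hx
    have h1 : |‖L ((2 / ‖x‖) • x)‖ ^ 2 - ‖(2 / ‖x‖) • x‖ ^ 2| ≤ M :=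
      hmax (by simpa using hscale x hx)
    rw [map_smul, norm_smul, norm_smul, mul_pow, mul_pow, ← mul_sub, abs_mul,
      abs_of_nonneg (by positivity), norm_div, norm_norm, Real.norm_ofNat, div_pow, div_mul_eq_mul_div,
      div_le_iff₀ (by positivity)] at h1
    linarith
  obtain ⟨c, hc, hvc⟩ := hnet v hv2
  have hc2 := hs c hc
  have hB := abs_inner_sub_inner_le L (LinearMap.id : V →ₗ[ℝ] V) hall (v - c) (v + c)
  -- With s = ‖v - c‖² < 1 the parallelogram law gives s(16 - s) < 15 < (31/8)². Hence M ≤ ε/8 +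
  -- (31/32)M below, that is M ≤ 4ε, which is why the net needs precision ε/32.
  have hprod : ‖v - c‖ * ‖v + c‖ ≤ 31 / 8 := by
    have hpar := parallelogram_law_with_norm ℝ v c
    rw [hv2, hc2] at hpar
    refine abs_le_of_sq_le_sq' ?_ (by norm_num) |>.2
    have : ‖v - c‖ * ‖v - c‖ < 1 := by nlinarith [norm_nonneg (v - c)]
    nlinarith [mul_self_nonneg ‖v - c‖]
  have hid : inner ℝ (L (v - c)) (L (v + c)) - inner ℝ (v - c) (v + c) =
      (‖L v‖ ^ 2 - ‖v‖ ^ 2) - (‖L c‖ ^ 2 - ‖c‖ ^ 2) := by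
    simp only [map_add, map_sub, inner_sub_left, inner_add_right, real_inner_self_eq_norm_sq]
    rw [real_inner_comm (L v) (L c), real_inner_comm v c]
    ring
  simp only [LinearMap.id_apply] at hB
  rw [hid] at hB
  have hM0 : 0 ≤ M := abs_nonneg _
  have hcs : |‖L c‖ ^ 2 - ‖c‖ ^ 2| ≤ ε / 32 * 2 ^ 2 := by simpa only [hc2] using h c hc
  have htri : M ≤ ε / 32 * 2 ^ 2 + M / 4 * (31 / 8) := by
    have h1 := abs_add_le ((‖L v‖ ^ 2 - ‖v‖ ^ 2) - (‖L c‖ ^ 2 - ‖c‖ ^ 2)) (‖L c‖ ^ 2 - ‖c‖ ^ 2)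
    rw [sub_add_cancel, ← hM] at h1
    have h2 : M / 4 * ‖v - c‖ * ‖v + c‖ ≤ M / 4 * (31 / 8) := by
      rw [mul_assoc]; gcongr
    exact h1.trans ((add_le_add (hB.trans h2) hcs).trans_eq (by ring))
  have hMε : M / 4 ≤ ε := by linarith
  exact (hall w).trans (by gcongr)

/-! ### Chi-squared concentration -/

/-- A unit linear form of a standard Gaussian vector is Gaussian. -/
theorem map_sum_mul_pi_gaussianReal {n : ℕ} {u : Vec n} (hu : ‖u‖ = 1) :
    (Measure.pi fun _ : Fin n => gaussianReal 0 1).map (fun x => ∑ i, x i * u i) =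
      gaussianReal 0 1 := by
  have h1 : (fun x : Fin n → ℝ => ∑ i, x i * u i) = (innerSL ℝ u) ∘ (WithLp.toLp 2) := by
    ext x
    simp [PiLp.inner_apply]
  rw [h1, ← Measure.map_map (by fun_prop) (by fun_prop), map_pi_eq_stdGaussian,
    IsGaussian.map_eq_gaussianReal, integral_strongDual_stdGaussian, variance_dual_stdGaussian]
  simp [hu]

/-- After squaring and using exp x ≥ 1 + x, it reduces to (1 + 2t + 8t²)(1 - 2t) = 1 + 4t²(1 - 4t) ≥
1. -/
theorem sqrt_one_div_one_sub_two_mul_le {t : ℝ} (ht : |t| ≤ 1 / 4) :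
    √(1 / (1 - 2 * t)) ≤ Real.exp (t + 4 * t ^ 2) := by
  obtain ⟨h1, h2⟩ := abs_le.1 ht
  have h3 : 0 < 1 - 2 * t := by linarith
  rw [Real.sqrt_le_left (Real.exp_pos _).le, div_le_iff₀ h3, ← Real.exp_nat_mul]
  have h4 := Real.add_one_le_exp (((2 : ℕ) : ℝ) * (t + 4 * t ^ 2))
  have h5 := mul_le_mul_of_nonneg_right h4 h3.le
  refine le_trans ?_ h5
  push_cast
  nlinarith [mul_nonneg (sq_nonneg t) (by linarith : 0 ≤ 1 - 4 * t)]

theorem gaussianPDFReal_zero_one_mul_exp (t x : ℝ) :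
    gaussianPDFReal 0 1 x * Real.exp (t * x ^ 2) =
      (√(2 * Real.pi))⁻¹ * Real.exp (-(1 / 2 - t) * x ^ 2) := by
  rw [gaussianPDFReal]
  simp only [NNReal.coe_one, mul_one, sub_zero]
  rw [mul_assoc, ← Real.exp_add]
  congr 2
  ring

theorem integrable_exp_mul_sq_gaussianReal {t : ℝ} (ht : t < 1 / 2) :
    Integrable (fun x => Real.exp (t * x ^ 2)) (gaussianReal 0 1) := by
  rw [gaussianReal_of_var_ne_zero _ one_ne_zero, integrable_withDensity_iff_integrable_smul'
    (measurable_gaussianPDF 0 1) (by simp [gaussianPDF])]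
  simp only [gaussianPDF, ENNReal.toReal_ofReal (gaussianPDFReal_nonneg 0 1 _), smul_eq_mul,
    gaussianPDFReal_zero_one_mul_exp]
  exact (integrable_exp_neg_mul_sq (by linarith)).const_mul _

theorem integral_exp_mul_sq_gaussianReal {t : ℝ} (ht : t < 1 / 2) :
    ∫ x, Real.exp (t * x ^ 2) ∂(gaussianReal 0 1) = √(1 / (1 - 2 * t)) := by
  rw [integral_gaussianReal_eq_integral_smul one_ne_zero]
  simp only [smul_eq_mul, gaussianPDFReal_zero_one_mul_exp]
  rw [integral_const_mul, integral_gaussian, ← Real.sqrt_inv,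
    ← Real.sqrt_mul (by positivity)]
  congr 1
  have : 1 - 2 * t ≠ 0 := by linarith
  have : 1 / 2 - t ≠ 0 := by linarith
  field_simp

/-- Chernoff bound for a centred chi-squared variable, with Chernoff parameter `t`. -/
theorem chiSquared_chernoff {m n : ℕ} {u : Vec n} (hu : ‖u‖ = 1) {t : ℝ} (ht : |t| ≤ 1 / 4)
    (a : ℝ) :
    (Measure.pi fun _ : Fin m => Measure.pi fun _ : Fin n => gaussianReal 0 1).real
      {P | a ≤ t * (∑ j, (∑ i, P j i * u i) ^ 2 - m)} ≤ Real.exp (4 * m * t ^ 2 - a) := by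
  set ν := Measure.pi fun _ : Fin n => gaussianReal 0 1 with hν
  have ht2 : t < 1 / 2 := by linarith [(abs_le.1 ht).2]
  set φ : (Fin n → ℝ) → ℝ := fun x => Real.exp (t * (∑ i, x i * u i) ^ 2) with hφ
  have hlin : Measurable fun x : Fin n → ℝ => ∑ i, x i * u i := by fun_prop
  have hφi : Integrable φ ν := by
    have := integrable_exp_mul_sq_gaussianReal ht2
    rw [← map_sum_mul_pi_gaussianReal hu] at this
    exact this.comp_measurable hlin
  have hφv : ∫ x, φ x ∂ν ≤ Real.exp (t + 4 * t ^ 2) := by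
    have := integral_exp_mul_sq_gaussianReal ht2
    rw [← map_sum_mul_pi_gaussianReal hu, integral_map hlin.aemeasurable (by fun_prop)] at this
    exact this.trans_le (sqrt_one_div_one_sub_two_mul_le ht)
  have hφ0 : 0 ≤ ∫ x, φ x ∂ν := integral_nonneg fun _ => (Real.exp_pos _).le
  have hprod : ∀ P : Fin m → Fin n → ℝ,
      Real.exp (t * (∑ j, (∑ i, P j i * u i) ^ 2 - m)) = (∏ j, φ (P j)) * Real.exp (-(m * t)) := by
    intro P
    rw [hφ, ← Real.exp_sum, ← Real.exp_add, ← Finset.mul_sum]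
    congr 1
    ring
  have hint : Integrable (fun P : Fin m → Fin n → ℝ =>
      Real.exp (1 * (t * (∑ j, (∑ i, P j i * u i) ^ 2 - m)))) (Measure.pi fun _ => ν) := by
    simp only [one_mul, hprod]
    exact (Integrable.fintype_prod fun _ => hφi).mul_const _
  -- The parameter `t`, of either sign, is already inside the variable, so the generating function
  -- is taken at 1 and one bound serves both tails.
  refine (measure_ge_le_exp_mul_mgf a zero_le_one hint).trans ?_
  have hmgf : mgf (fun P : Fin m → Fin n → ℝ => t * (∑ j, (∑ i, P j i * u i) ^ 2 - m))
      (Measure.pi fun _ => ν) 1 ≤ Real.exp (t + 4 * t ^ 2) ^ m * Real.exp (-(m * t)) := by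
    simp only [mgf, one_mul, hprod]
    rw [integral_mul_const, integral_fintype_prod_eq_pow, Fintype.card_fin]
    gcongr
  refine (mul_le_mul_of_nonneg_left hmgf (Real.exp_pos _).le).trans_eq ?_
  rw [← Real.exp_nat_mul, ← Real.exp_add, ← Real.exp_add]
  congr 1
  ring

theorem chiSquared_tail {m n : ℕ} {u : Vec n} (hu : ‖u‖ = 1) {η : ℝ} (h0 : 0 ≤ η) (h1 : η ≤ 1) :
    (Measure.pi fun _ : Fin m => Measure.pi fun _ : Fin n => gaussianReal 0 1).real
      {P | η * m < |∑ j, (∑ i, P j i * u i) ^ 2 - m|} ≤ 2 * Real.exp (-(m * η ^ 2 / 16)) := by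
  have hη : |η / 8| ≤ 1 / 4 := by rw [abs_of_nonneg (by positivity)]; linarith
  have hη' : |-(η / 8)| ≤ 1 / 4 := by rwa [abs_neg]
  -- The choice t = ±η/8 minimizes 4mt² - |t|ηm.
  have A := chiSquared_chernoff (m := m) hu hη (η / 8 * (η * m))
  have B := chiSquared_chernoff (m := m) hu hη' (η / 8 * (η * m))
  have e1 : 4 * m * (η / 8) ^ 2 - η / 8 * (η * m) = -(m * η ^ 2 / 16) := by ring
  have e2 : 4 * m * (-(η / 8)) ^ 2 - η / 8 * (η * m) = -(m * η ^ 2 / 16) := by ring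
  rw [e1] at A
  rw [e2] at B
  rw [two_mul]
  refine le_trans (measureReal_mono ?_) ((measureReal_union_le _ _).trans (add_le_add A B))
  intro P hP
  rcases lt_abs.1 (show η * m < |_| from hP) with h | h
  · left
    exact mul_le_mul_of_nonneg_left h.le (by positivity)
  · right
    change _ ≤ -(η / 8) * _
    rw [neg_mul_comm]
    exact mul_le_mul_of_nonneg_left h.le (by positivity)

theorem measurable_of_div_sqrt (m n : ℕ) : Measurable (fun P' : Fin m → Fin n → ℝ =>
    (Matrix.of fun j i => P' j i / √(m : ℝ) : Matrix (Fin m) (Fin n) ℝ)) := by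
  refine measurable_pi_lambda (X := fun _ : Fin m => Fin n → ℝ) _ fun j =>
    measurable_pi_lambda _ fun i => ?_
  simp only [Matrix.of_apply]
  fun_prop

instance isProbabilityMeasure_gaussianSketch (m n : ℕ) :
    IsProbabilityMeasure (gaussianSketch m n) :=
  Measure.isProbabilityMeasure_map (measurable_of_div_sqrt m n).aemeasurable

/-! ### Gaussian embedding: the union bound -/

/-- The distortion of one vector under the Gaussian sketch. -/
theorem gaussianSketch_tail {m n : ℕ} (hm : 0 < m) (u : Vec n) {η : ℝ} (h0 : 0 ≤ η)
    (h1 : η ≤ 1) :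
    (gaussianSketch m n).real {P | ¬ |‖Matrix.toEuclideanLin P u‖ ^ 2 - ‖u‖ ^ 2| ≤ η * ‖u‖ ^ 2} ≤
      2 * Real.exp (-(m * η ^ 2 / 16)) := by
  rcases eq_or_ne u 0 with rfl | hu
  · simp; positivity
  have hu0 : 0 < ‖u‖ := norm_pos_iff.2 hu
  have hm0 : (0 : ℝ) < m := by exact_mod_cast hm
  have hmeas : MeasurableSet {P : Matrix (Fin m) (Fin n) ℝ |
      ¬ |‖Matrix.toEuclideanLin P u‖ ^ 2 - ‖u‖ ^ 2| ≤ η * ‖u‖ ^ 2} := by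
    simp only [← real_inner_self_eq_norm_sq]
    exact (measurableSet_le ((measurable_inner_toEuclideanLin u u).sub_const _).abs
      measurable_const).compl
  rw [gaussianSketch, map_measureReal_apply (measurable_of_div_sqrt m n) hmeas]
  refine (measureReal_mono ?_).trans
    (chiSquared_tail (m := m) (u := ‖u‖⁻¹ • u) (by simp [norm_smul, hu0.ne']) h0 h1)
  intro P hP
  simp only [Set.mem_preimage, Set.mem_ofPred_eq, not_le, ← real_inner_self_eq_norm_sq,
    inner_toEuclideanLin, Matrix.of_apply] at hP ⊢
  have e : ∀ k, ∑ i, P k i * (‖u‖⁻¹ • u) i = ‖u‖⁻¹ * ∑ i, P k i * u i := fun k => by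
    rw [Finset.mul_sum]
    exact Finset.sum_congr rfl fun i _ => by simp; ring
  have e' : ∀ k, ∑ i, P k i / √(m : ℝ) * u i = (√(m : ℝ))⁻¹ * ∑ i, P k i * u i := fun k => by
    rw [Finset.mul_sum]
    exact Finset.sum_congr rfl fun i _ => by ring
  have e2 : ∑ k, (∑ i, P k i / √(m : ℝ) * u i) * ∑ i, P k i / √(m : ℝ) * u i =
      (∑ k, (∑ i, P k i * u i) ^ 2) / m := by
    rw [Finset.sum_div]
    refine Finset.sum_congr rfl fun k _ => ?_
    rw [e']
    nth_rewrite 3 [← Real.sq_sqrt hm0.le]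
    field_simp
  rw [e2, real_inner_self_eq_norm_sq] at hP
  simp only [e, mul_pow, ← Finset.mul_sum]
  have e3 : ‖u‖⁻¹ ^ 2 * ∑ k, (∑ i, P k i * u i) ^ 2 - m =
      (m / ‖u‖ ^ 2) * ((∑ k, (∑ i, P k i * u i) ^ 2) / m - ‖u‖ ^ 2) := by
    field_simp
  rw [e3, abs_mul, abs_of_pos (by positivity)]
  calc η * m = m / ‖u‖ ^ 2 * (η * ‖u‖ ^ 2) := by field_simp
    _ < _ := by gcongr

/-- The Gaussian sketch is a subspace embedding with high probability. -/
theorem gaussianSketch_isSubspaceEmbedding {m n d : ℕ} {ε δ : ℝ} (hε : 0 < ε) (hε1 : ε < 1)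
    (hδ : 0 < δ) (hδ1 : δ < 1) (X : Matrix (Fin n) (Fin d) ℝ)
    (hm : 49152 * ((X.rank : ℝ) + Real.log (1 / δ)) / ε ^ 2 ≤ m) :
    HoldsWithProb (gaussianSketch m n) (1 - δ) fun P => IsSubspaceEmbedding ε P X := by
  have hlog : 0 < Real.log (1 / δ) := Real.log_pos (by rw [lt_div_iff₀ hδ]; linarith)
  have hm0 : 0 < m := by
    have : (0 : ℝ) < m := lt_of_lt_of_le (by positivity) hm
    exact_mod_cast this
  obtain ⟨s, hs, hcard, hnet⟩ := exists_finset_net_sphere (Matrix.toEuclideanLin X).range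
  rw [finrank_range_toEuclideanLin] at hcard
  -- Rank 0 is separate because the factor 2 of the two-sided tail is absorbed below as 2 ≤ 2^r.
  rcases Nat.eq_zero_or_pos X.rank with hr | hr
  · have hsub : Subsingleton (Matrix.toEuclideanLin X).range :=
      Module.finrank_zero_iff.1 ((finrank_range_toEuclideanLin X).trans hr)
    refine HoldsWithProb.mono (Q := fun _ => True)
      ⟨Set.univ, MeasurableSet.univ, ?_, fun _ _ => trivial⟩ fun P _ =>
        isSubspaceEmbedding_of_range fun w => ?_
    · rw [measure_univ]
      exact ENNReal.ofReal_le_one.2 (by linarith)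
    · rw [Subsingleton.elim w 0]
      simp
  have hmeas : ∀ c ∈ s, MeasurableSet {P : Matrix (Fin m) (Fin n) ℝ |
      |‖Matrix.toEuclideanLin P c‖ ^ 2 - ‖(c : Vec n)‖ ^ 2| ≤ ε / 32 * ‖(c : Vec n)‖ ^ 2} := by
    intro c _
    simp only [← real_inner_self_eq_norm_sq]
    exact measurableSet_le ((measurable_inner_toEuclideanLin _ _).sub_const _).abs measurable_const
  refine HoldsWithProb.mono (Q := fun P => ∀ c ∈ s,
      |‖Matrix.toEuclideanLin P c‖ ^ 2 - ‖(c : Vec n)‖ ^ 2| ≤ ε / 32 * ‖(c : Vec n)‖ ^ 2)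
    (HoldsWithProb.of_compl ?_ ?_) fun P hP => isSubspaceEmbedding_of_range
      (abs_norm_sq_sub_norm_sq_le_of_net
        ((Matrix.toEuclideanLin P).comp (Matrix.toEuclideanLin X).range.subtype) hs hnet hP)
  · have := Finset.measurableSet_biInter s hmeas
    convert this using 1
    ext P
    simp
  · set η := ε / 32 with hη
    have hunion : {P : Matrix (Fin m) (Fin n) ℝ | ¬ ∀ c ∈ s,
        |‖Matrix.toEuclideanLin P c‖ ^ 2 - ‖(c : Vec n)‖ ^ 2| ≤ η * ‖(c : Vec n)‖ ^ 2} ⊆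
        ⋃ c ∈ s, {P | ¬ |‖Matrix.toEuclideanLin P c‖ ^ 2 - ‖(c : Vec n)‖ ^ 2| ≤
          η * ‖(c : Vec n)‖ ^ 2} := by
      intro P hP
      obtain ⟨c, hP⟩ := not_forall.1 hP
      obtain ⟨hc, hP⟩ := not_forall.1 hP
      exact Set.mem_biUnion hc hP
    refine (measureReal_mono hunion (measure_ne_top _ _)).trans ((measureReal_biUnion_finset_le _ _).trans ?_)
    refine (Finset.sum_le_sum fun (c : (Matrix.toEuclideanLin X).range) _ =>
      gaussianSketch_tail (η := η) hm0 (c : Vec n) (by positivity)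
      (by linarith)).trans ?_
    rw [Finset.sum_const, nsmul_eq_mul]
    -- The constant is 49152 = 3 · 16 · 32², so the exponent is at least 3(r + log(1/δ)); then
    -- e^(-3r) beats the factor 10^r from the net and the two tails.
    have hexp : Real.exp (-(m * η ^ 2 / 16)) ≤ Real.exp (-3) ^ X.rank * δ := by
      rw [← Real.exp_nat_mul]
      nth_rewrite 1 [← Real.exp_log hδ]
      rw [← Real.exp_add, Real.exp_le_exp]
      rw [one_div, Real.log_inv] at hm hlog
      rw [div_le_iff₀ (by positivity)] at hm
      rw [hη]
      nlinarith
    have he : (10 : ℝ) * Real.exp (-3) ≤ 1 := by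
      have h3 : (10 : ℝ) ≤ Real.exp 3 := by
        have := Real.exp_one_gt_d9
        have h2 : Real.exp 3 = Real.exp 1 ^ 3 := by rw [← Real.exp_nat_mul]; norm_num
        rw [h2]
        calc (10 : ℝ) ≤ 2.7 ^ 3 := by norm_num
          _ ≤ _ := by gcongr; linarith
      rw [Real.exp_neg, ← div_eq_mul_inv, div_le_one (Real.exp_pos _)]
      exact h3
    have h2 : (2 : ℝ) ≤ 2 ^ X.rank := le_self_pow₀ one_le_two (by omega)
    calc (s.card : ℝ) * (2 * Real.exp (-(m * η ^ 2 / 16)))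
        ≤ 5 ^ X.rank * (2 ^ X.rank * (Real.exp (-3) ^ X.rank * δ)) := by
          gcongr
          exact_mod_cast hcard
      _ = (10 * Real.exp (-3)) ^ X.rank * δ := by
          rw [← mul_assoc, ← mul_assoc, ← mul_pow, ← mul_pow]; norm_num
      _ ≤ 1 * δ := by
          gcongr
          exact pow_le_one₀ (by positivity) he
      _ = δ := one_mul δ

end Gaussian


/-! ### Assembly -/

theorem mainTheorem1 :
    -- the error bound for an arbitrary oblivious subspace embedding
    (∀ (m n d : ℕ) (ε δ : ℝ), 0 < ε → ε < 1 → 0 < δ → δ < 1 →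
      ∀ μ : Measure (Matrix (Fin m) (Fin n) ℝ), IsProbabilityMeasure μ →
        IsObliviousSubspaceEmbedding d ε δ μ →
        ∀ (X : Matrix (Fin n) (Fin d) ℝ) (y : Vec n) (h : Vec d → ℝ),
          HoldsWithProb μ (1 - δ) (fun P => SketchErrorBound ε P X y h)) ∧
    -- the sketch size for Gaussian subspace embeddings
    (∃ C : ℝ, 0 < C ∧
      ∀ (m n d : ℕ) (ε δ : ℝ), 0 < ε → ε < 1 → 0 < δ → δ < 1 →
        ∀ X : Matrix (Fin n) (Fin d) ℝ,
          C * ((X.rank : ℝ) + Real.log (1 / δ)) / ε ^ 2 ≤ (m : ℝ) →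
          ∀ (y : Vec n) (h : Vec d → ℝ),
            HoldsWithProb (gaussianSketch m n) (1 - δ)
              (fun P => IsSubspaceEmbedding ε P X ∧ SketchErrorBound ε P X y h)) ∧
    -- the sketch size for sparse subspace embeddings
    (∃ C : ℝ, 0 < C ∧
      ∀ (m n d : ℕ) [NeZero m] (ε δ : ℝ), 0 < ε → ε < 1 → 0 < δ → δ < 1 →
        ∀ X : Matrix (Fin n) (Fin d) ℝ,
          C * (X.rank : ℝ) ^ 2 / (δ * ε ^ 2) ≤ (m : ℝ) →
          ∀ (y : Vec n) (h : Vec d → ℝ),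
            HoldsWithProb (sparseSketch m n) (1 - δ)
              (fun P => IsSubspaceEmbedding ε P X ∧ SketchErrorBound ε P X y h)) := by
  refine ⟨?_, ⟨49152, by norm_num, ?_⟩, ⟨2, by norm_num, ?_⟩⟩
  · intro m n d ε δ _ _ _ _ μ _ hμ X y h
    exact (hμ X).mono fun P hP => hP.sketchErrorBound y h
  · intro m n d ε δ hε hε1 hδ hδ1 X hm y h
    exact (gaussianSketch_isSubspaceEmbedding hε hε1 hδ hδ1 X hm).mono fun P hP =>
      ⟨hP, hP.sketchErrorBound y h⟩
  · intro m n d _ ε δ hε _ hδ _ X hm y h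
    exact (sparseSketch_isSubspaceEmbedding hε hδ X hm).mono fun P hP =>
      ⟨hP, hP.sketchErrorBound y h⟩
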